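/- For an integer $m\ge 2$ put $\omega_m=e^{2\pi i/m}$, and let $\zeta$ be the Riemann zeta function. Then for every integer $m\ge 2$ the following series converges absolutely and $$\zeta(m)=\sum_{n=1}^{\infty}\frac{m(-1)^{n-1}\,\Gamma(1-\omega_m n)\,\Gamma(1-\omega_m^{2}n)\cdots\Gamma(1-\omega_m^{m-1}n)}{n!\,n^m}.$$ As a special case, Apéry's constant has the (absolutely convergent) series representation $$\zeta(3)=\sum_{n=1}^{\infty}\frac{3(-1)^{n-1}\,\Gamma\!\left(\frac{1+i\sqrt3}{2}\,n\right)\Gamma\!\left(\frac{1-i\sqrt3}{2}\,n\right)}{n\cdot n!}.$$ -/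

import Mathlib

/-- The primitive `m`-th root of unity `ω_m = exp (2 π i / m)`. -/
noncomputable def omegaRoot (m : ℕ) : ℂ :=
  Complex.exp (2 * (Real.pi : ℂ) * Complex.I / (m : ℂ))

/-- The `n`-th term (`n ≥ 1`) of the series representing `ζ(m)`:
`m (-1)^(n-1) Γ(1 - ω_m n) ⋯ Γ(1 - ω_m^(m-1) n) / (n! n^m)`. -/
noncomputable def zetaTerm (m n : ℕ) : ℂ :=
  (m : ℂ) * (-1) ^ (n - 1) *
      (∏ r ∈ Finset.Icc 1 (m - 1), Complex.Gamma (1 - omegaRoot m ^ r * (n : ℂ))) /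
    ((n.factorial : ℂ) * (n : ℂ) ^ m)

/-- The `n`-th term (`n ≥ 1`) of the series representing `ζ(3)`:
`3 (-1)^(n-1) Γ((1 + i√3) n / 2) Γ((1 - i√3) n / 2) / (n · n!)`. -/
noncomputable def aperyTerm (n : ℕ) : ℂ :=
  3 * (-1) ^ (n - 1) *
      Complex.Gamma ((1 + Complex.I * (Real.sqrt 3 : ℂ)) / 2 * (n : ℂ)) *
      Complex.Gamma ((1 - Complex.I * (Real.sqrt 3 : ℂ)) / 2 * (n : ℂ)) /
    ((n : ℂ) * (n.factorial : ℂ))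

open Finset Filter Topology
-- Lagrange interpolation at the nodes `1 / k ^ m`, `k ≤ N`, gives a finite identity: `∑ 1 / n ^ m`
-- over `n ≤ N` is unchanged when each term is weighted by `partialCoeff m N n`
-- (`sum_partialCoeff_div_pow`). For fixed `n`, factoring `k ^ m - n ^ m` over the roots of unity
-- and applying Euler's limit for `Γ` shows that the weighted term tends to `zetaTerm m n`
-- (`tendsto_partialCoeff`). The weights are at most 2 in absolute value
-- (`abs_partialCoeff_le_two`), so dominated convergence yields the series and its absolute
-- convergence.
theorem sum_mul_prod_inv_one_sub_div {K ι : Type*} [Field K] [DecidableEq ι] (s : Finset ι) (x : ι → K)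
    (hx : Set.InjOn x s) (h0 : ∀ i ∈ s, x i ≠ 0) :
    ∑ i ∈ s, x i * ∏ j ∈ s.erase i, (1 - x j / x i)⁻¹ = ∑ i ∈ s, x i := by
  rcases s.eq_empty_or_nonempty with rfl | hs
  · simp
  have hc := hs.card_pos
  -- The leading terms cancel, `P (x i) = x i ^ #s`, and the next coefficient is `∑ x i`; Lagrange's
  -- formula expresses that coefficient through the values at the nodes.
  set P : Polynomial K := Polynomial.X ^ #s - ∏ i ∈ s, (Polynomial.X - Polynomial.C (x i)) with hP
  have hmon : (∏ i ∈ s, (Polynomial.X - Polynomial.C (x i))).Monic :=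
    Polynomial.monic_prod_of_monic _ _ fun i _ => Polynomial.monic_X_sub_C _
  have hdeg : (∏ i ∈ s, (Polynomial.X - Polynomial.C (x i))).degree = (#s : WithBot ℕ) := by
    simp [Polynomial.degree_prod]
  have hPdeg : P.degree < #s := by
    rw [← Polynomial.degree_X_pow (R := K) #s]
    refine Polynomial.degree_sub_lt_left ?_ (pow_ne_zero _ Polynomial.X_ne_zero) ?_
    · rw [hdeg, Polynomial.degree_X_pow]
    · rw [hmon.leadingCoeff, (Polynomial.monic_X_pow _).leadingCoeff]
  have h := Lagrange.coeff_eq_sum hx hPdeg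
  have hcoeff : P.coeff (#s - 1) = ∑ i ∈ s, x i := by
    rw [hP, Polynomial.coeff_sub, Polynomial.prod_X_sub_C_coeff_card_pred s x hc,
      Polynomial.coeff_X_pow, if_neg (by omega)]
    simp
  rw [← hcoeff, h]
  refine sum_congr rfl fun i hi => ?_
  have heval : P.eval (x i) = x i ^ #s := by
    simp [hP, Polynomial.eval_prod, prod_eq_zero hi]
  have hpow : x i ^ #s = x i * ∏ j ∈ s.erase i, x i := by
    rw [prod_const, card_erase_of_mem hi, ← pow_succ', Nat.sub_add_cancel hc]
  rw [heval, hpow, mul_div_assoc, ← prod_div_distrib]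
  congr 1
  refine prod_congr rfl fun j hj => ?_
  have := h0 i hi
  rw [one_sub_div this, inv_div]

/-! ### Factorial products with one factor removed -/

theorem prod_erase_Icc_natCast_sub {K : Type*} [CommRing K] {n N : ℕ} (hn : 1 ≤ n) (hN : n ≤ N) :
    ∏ k ∈ (Icc 1 N).erase n, ((k : K) - n) = (-1) ^ (n - 1) * (n - 1).factorial * (N - n).factorial := by
  induction N, hN using Nat.le_induction with
  | base =>
    obtain ⟨p, rfl⟩ : ∃ p, n = p + 1 := ⟨n - 1, by omega⟩
    have : (Icc 1 (p + 1)).erase (p + 1) = Ico 1 (p + 1) := by grind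
    rw [this, prod_Ico_eq_prod_range, ← prod_range_reflect]
    have h2 : ∀ j ∈ range p, (((1 + (p - 1 - j) : ℕ) : K) - ((p + 1 : ℕ) : K)) = -1 * ((j + 1 : ℕ) : K) := by
      intro j hj
      rw [mem_range] at hj
      have : ((1 + (p - 1 - j) : ℕ) : K) + ((j + 1 : ℕ) : K) = ((p + 1 : ℕ) : K) := by
        rw [← Nat.cast_add]; congr 1; omega
      rw [← this]; ring
    simp only [Nat.add_sub_cancel, Nat.sub_self, Nat.factorial_zero, Nat.cast_one, mul_one]
    rw [prod_congr rfl h2, prod_mul_distrib, ← Nat.cast_prod, prod_range_add_one_eq_factorial]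
    simp
  | succ N hN ih =>
    have : (Icc 1 (N + 1)).erase n = insert (N + 1) ((Icc 1 N).erase n) := by ext; simp; omega
    rw [this, prod_insert (by simp), ih, Nat.succ_sub hN, Nat.factorial_succ]
    have : ((N + 1 : ℕ) : K) - n = ((N - n + 1 : ℕ) : K) := by
      rw [sub_eq_iff_eq_add, ← Nat.cast_add]; congr 1; omega
    rw [this]; push_cast; ring

/-- Raising `n` by one multiplies the right side by `(N + n + 1) / (N - n) ≥ 1`. -/
theorem factorial_sq_le_sub_mul_add {n N : ℕ} (hN : n ≤ N) :
    N.factorial ^ 2 ≤ (N - n).factorial * (N + n).factorial := by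
  induction n with
  | zero => simp [sq]
  | succ n ih =>
    refine (ih (by omega)).trans ?_
    obtain ⟨d, rfl⟩ : ∃ d, N = d + (n + 1) := ⟨N - (n + 1), by omega⟩
    rw [show d + (n + 1) - n = d + 1 by omega, Nat.add_sub_cancel,
      ← add_assoc (d + (n + 1)), Nat.factorial_succ, Nat.factorial_succ, mul_comm (d + 1), mul_assoc]
    gcongr
    omega

theorem prod_erase_Icc_natCast_add {n N : ℕ} (hn : 1 ≤ n) (hN : n ≤ N) :
    (∏ k ∈ (Icc 1 N).erase n, (k + n)) * (n.factorial * (2 * n)) = (N + n).factorial := by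
  have h1 : n ∈ Icc 1 N := by simp; omega
  have h2 : (∏ k ∈ Icc 1 N, (k + n)) * n.factorial = (N + n).factorial := by
    clear hN h1
    induction N with
    | zero => simp
    | succ N ih =>
      rw [prod_Icc_succ_top (by omega), mul_right_comm, ih, show N + 1 + n = N + n + 1 by ring,
        Nat.factorial_succ, mul_comm]
  rw [← h2, ← prod_erase_mul _ _ h1]; ring

theorem prod_erase_Icc_natCast {n N : ℕ} (hn : 1 ≤ n) (hN : n ≤ N) :
    (∏ k ∈ (Icc 1 N).erase n, k) * n = N.factorial := by
  rw [prod_erase_mul _ _ (by simp; omega), ← Ico_add_one_right_eq_Icc, prod_Ico_id_eq_factorial]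

/-! ### The weights and their uniform bound -/

/-- The coefficient of `(1 - w / n ^ m)⁻¹` in the partial fraction expansion of
`∏ k ∈ Icc 1 N, (1 - w / k ^ m)⁻¹`. -/
noncomputable def partialCoeff (m N n : ℕ) : ℝ :=
  ∏ k ∈ (Icc 1 N).erase n, (1 - ((n : ℝ) / k) ^ m)⁻¹

theorem sum_partialCoeff_div_pow {m : ℕ} (hm : m ≠ 0) (N : ℕ) :
    ∑ n ∈ Icc 1 N, partialCoeff m N n / (n : ℝ) ^ m = ∑ n ∈ Icc 1 N, 1 / (n : ℝ) ^ m := by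
  have h := sum_mul_prod_inv_one_sub_div (Icc 1 N) (fun k : ℕ => 1 / (k : ℝ) ^ m) ?_ ?_
  · rw [← h]
    refine sum_congr rfl fun n hn => ?_
    rw [partialCoeff, div_eq_mul_one_div, mul_comm]
    congr 1
    refine prod_congr rfl fun k hk => ?_
    rw [div_pow, one_div, one_div, inv_div_inv]
  · intro a _ b _ hab
    have : (a : ℝ) ^ m = (b : ℝ) ^ m := by simpa using hab
    exact_mod_cast (pow_left_inj₀ (Nat.cast_nonneg a) (Nat.cast_nonneg b) hm).1 this
  · intro k hk
    have : k ≠ 0 := by simp at hk; omega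
    positivity

theorem abs_one_sub_pow_mono {x : ℝ} (hx : 0 ≤ x) {a b : ℕ} (hab : a ≤ b) :
    |1 - x ^ a| ≤ |1 - x ^ b| := by
  rcases le_total x 1 with h | h
  · have h1 := pow_le_one₀ (n := a) hx h
    have h2 := pow_le_pow_of_le_one hx h hab
    rw [abs_of_nonneg (by linarith), abs_of_nonneg (by linarith)]
    linarith
  · have h1 := one_le_pow₀ (n := a) h
    have h2 := pow_le_pow_right₀ h hab
    rw [abs_of_nonpos (by linarith), abs_of_nonpos (by linarith)]
    linarith

theorem natCast_div_pow_ne_one {m n k : ℕ} (hm : m ≠ 0) (hk : k ≠ 0) (hkn : k ≠ n) :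
    ((n : ℝ) / k) ^ m ≠ 1 := by
  rw [Ne, pow_eq_one_iff_of_nonneg (by positivity) hm, div_eq_one_iff_eq (by positivity)]
  exact_mod_cast hkn.symm

/-- Each `|1 - x ^ a|` grows with `a`, whether `x ≤ 1` or `x ≥ 1`. This reduces the bound to
exponent 2, where the weight is an explicit quotient of factorials. -/
theorem abs_partialCoeff_le_of_le {a b n N : ℕ} (ha : a ≠ 0) (hab : a ≤ b) :
    |partialCoeff b N n| ≤ |partialCoeff a N n| := by
  rw [partialCoeff, partialCoeff, abs_prod, abs_prod]
  refine prod_le_prod (fun _ _ => abs_nonneg _) fun k hk => ?_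
  rw [mem_erase, mem_Icc] at hk
  rw [abs_inv, abs_inv]
  have : 0 < |1 - ((n : ℝ) / k) ^ a| :=
    abs_pos.2 (sub_ne_zero.2 (natCast_div_pow_ne_one ha (by omega) hk.1).symm)
  gcongr ?_⁻¹
  exact abs_one_sub_pow_mono (by positivity) hab

theorem abs_partialCoeff_two {n N : ℕ} (hn : 1 ≤ n) (hN : n ≤ N) :
    |partialCoeff 2 N n| = 2 * N.factorial ^ 2 / ((N - n).factorial * (N + n).factorial) := by
  have h : ∀ k ∈ (Icc 1 N).erase n, |(1 - ((n : ℝ) / k) ^ 2)⁻¹| =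
      (k : ℝ) ^ 2 / (|(k : ℝ) - n| * (k + n : ℕ)) := by
    intro k hk
    rw [mem_erase, mem_Icc] at hk
    have hk0 : (k : ℝ) ≠ 0 := by norm_cast; omega
    rw [div_pow, one_sub_div (pow_ne_zero _ hk0), inv_div, abs_div, abs_of_nonneg (by positivity),
      sq_sub_sq, abs_mul, mul_comm |(k : ℝ) + n|, ← Nat.cast_add, Nat.abs_cast]
  have h1 := congrArg (Nat.cast (R := ℝ)) (prod_erase_Icc_natCast hn hN)
  have h2 := congrArg (Nat.cast (R := ℝ)) (prod_erase_Icc_natCast_add hn hN)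
  have h3 := prod_erase_Icc_natCast_sub (K := ℝ) hn hN
  rw [Nat.cast_mul, Nat.cast_prod] at h1 h2
  rw [partialCoeff, abs_prod, prod_congr rfl h, prod_div_distrib, prod_mul_distrib, prod_pow,
    ← abs_prod, h3, ← h1, ← h2, abs_mul, abs_mul, abs_pow, abs_neg, abs_one, one_pow, one_mul,
    Nat.abs_cast, Nat.abs_cast]
  have hA : ∏ k ∈ (Icc 1 N).erase n, ((k + n : ℕ) : ℝ) ≠ 0 :=
    prod_ne_zero_iff.2 fun k _ => by norm_cast; omega
  obtain ⟨p, rfl⟩ : ∃ p, n = p + 1 := ⟨n - 1, by omega⟩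
  rw [Nat.factorial_succ, Nat.add_sub_cancel]
  push_cast at hA ⊢
  field_simp

theorem abs_partialCoeff_le_two {m n N : ℕ} (hm : 2 ≤ m) (hn : 1 ≤ n) (hN : n ≤ N) :
    |partialCoeff m N n| ≤ 2 := by
  refine (abs_partialCoeff_le_of_le two_ne_zero hm).trans ?_
  rw [abs_partialCoeff_two hn hN, div_le_iff₀ (by positivity)]
  gcongr
  exact_mod_cast factorial_sq_le_sub_mul_add hN

/-! ### Limit of the weights through Euler's formula for `Γ` -/

theorem omegaRoot_isPrimitiveRoot {m : ℕ} (hm : m ≠ 0) : IsPrimitiveRoot (omegaRoot m) m :=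
  Complex.isPrimitiveRoot_exp m hm

theorem range_eq_insert_zero_Icc {m : ℕ} (hm : m ≠ 0) : range m = insert 0 (Icc 1 (m - 1)) := by
  ext; simp; omega

theorem sum_Icc_omegaRoot_pow {m : ℕ} (hm : 2 ≤ m) : ∑ r ∈ Icc 1 (m - 1), omegaRoot m ^ r = -1 := by
  have h := (omegaRoot_isPrimitiveRoot (m := m) (by omega)).geom_sum_eq_zero (by omega)
  rw [range_eq_insert_zero_Icc (by omega), sum_insert (by simp), pow_zero] at h
  exact (neg_eq_of_add_eq_zero_right h).symm

theorem prod_Icc_sub_omegaRoot_pow_mul {m : ℕ} (hm : m ≠ 0) (x y : ℂ) :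
    ∏ r ∈ Icc 1 (m - 1), (x - omegaRoot m ^ r * y) = ∑ i ∈ range m, x ^ i * y ^ (m - 1 - i) := by
  have h := X_pow_sub_C_eq_prod (omegaRoot_isPrimitiveRoot hm) (Nat.pos_of_ne_zero hm) (α := y) rfl
  rw [range_eq_insert_zero_Icc hm, prod_insert (by simp), pow_zero, one_mul, Polynomial.C_pow,
    ← (Commute.all _ _).mul_geom_sum₂] at h
  have h2 := congrArg (Polynomial.eval x) (mul_left_cancel₀ (Polynomial.X_sub_C_ne_zero y) h)
  simpa [Polynomial.eval_prod, Polynomial.eval_finsetSum] using h2.symm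

/-- The nontrivial roots of unity sum to `-1`, so the complex exponents add up to a natural number.
-/
theorem prod_cpow_one_sub_omegaRoot {m n N : ℕ} (hm : 2 ≤ m) (hN : N ≠ 0) :
    ∏ r ∈ Icc 1 (m - 1), (N : ℂ) ^ (1 - omegaRoot m ^ r * n) = (N : ℂ) ^ (m - 1 + n) := by
  have hN' : (N : ℂ) ≠ 0 := Nat.cast_ne_zero.2 hN
  rw [← Complex.cpow_natCast]
  simp only [Complex.cpow_def_of_ne_zero hN']
  rw [← Complex.exp_sum, ← mul_sum, sum_sub_distrib, ← sum_mul, sum_Icc_omegaRoot_pow hm]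
  simp

theorem prod_GammaSeq_eq {m n N : ℕ} (hm : 2 ≤ m) (hN : N ≠ 0) :
    ∏ r ∈ Icc 1 (m - 1), Complex.GammaSeq (1 - omegaRoot m ^ r * n) N =
      (N : ℂ) ^ (m - 1 + n) * (N.factorial : ℂ) ^ (m - 1) /
        ∏ k ∈ Icc 1 (N + 1), ∑ i ∈ range m, (k : ℂ) ^ i * (n : ℂ) ^ (m - 1 - i) := by
  simp only [Complex.GammaSeq]
  rw [prod_div_distrib, prod_mul_distrib, prod_cpow_one_sub_omegaRoot hm hN, prod_const,
    Nat.card_Icc, Nat.add_sub_cancel, Finset.prod_comm, ← Ico_add_one_right_eq_Icc 1 (N + 1), prod_Ico_eq_prod_range,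
    Nat.add_sub_cancel]
  congr 1
  refine prod_congr rfl fun j _ => ?_
  rw [← prod_Icc_sub_omegaRoot_pow_mul (by omega)]
  refine prod_congr rfl fun r _ => ?_
  push_cast; ring

/-- For `k ≠ n` the geometric sum times `k - n` is `k ^ m - n ^ m`, which the weight turns into `k ^
m`; the factor `k = n` is `m * n ^ (m - 1)`. -/
theorem prod_Icc_geom_sum₂ {m n N : ℕ} (hm : 2 ≤ m) (hn : 1 ≤ n) (hN : n ≤ N) :
    (∏ k ∈ Icc 1 N, ∑ i ∈ range m, (k : ℂ) ^ i * (n : ℂ) ^ (m - 1 - i)) *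
        ((-1) ^ (n - 1) * (n - 1).factorial * (N - n).factorial) * (n * partialCoeff m N n) =
      m * (N.factorial : ℂ) ^ m := by
  have hn0 : (n : ℂ) ≠ 0 := Nat.cast_ne_zero.2 (by omega)
  have hq : ∑ i ∈ range m, (n : ℂ) ^ i * (n : ℂ) ^ (m - 1 - i) = m * (n : ℂ) ^ (m - 1) := by
    exact geom_sum₂_self _ _
  have h1 := congrArg (Nat.cast (R := ℂ)) (prod_erase_Icc_natCast hn hN)
  rw [Nat.cast_mul, Nat.cast_prod] at h1
  have hpc : (partialCoeff m N n : ℂ) = ∏ k ∈ (Icc 1 N).erase n, (1 - ((n : ℂ) / k) ^ m)⁻¹ := by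
    simp [partialCoeff]
  have key : (∏ k ∈ (Icc 1 N).erase n, ∑ i ∈ range m, (k : ℂ) ^ i * (n : ℂ) ^ (m - 1 - i)) *
      (∏ k ∈ (Icc 1 N).erase n, ((k : ℂ) - n)) * partialCoeff m N n =
      (∏ k ∈ (Icc 1 N).erase n, (k : ℂ)) ^ m := by
    rw [hpc, ← prod_mul_distrib, ← prod_mul_distrib, ← prod_pow]
    refine prod_congr rfl fun k hk => ?_
    rw [mem_erase, mem_Icc] at hk
    have hk0 : (k : ℂ) ≠ 0 := Nat.cast_ne_zero.2 (by omega)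
    have hne : (1 - ((n : ℂ) / k) ^ m) ≠ 0 := by
      have := natCast_div_pow_ne_one (m := m) (by omega) (k := k) (by omega) hk.1
      refine sub_ne_zero.2 fun h => this ?_
      have h' : ((1 : ℝ) : ℂ) = ((((n : ℝ) / k) ^ m : ℝ) : ℂ) := by push_cast; exact h
      exact (Complex.ofReal_injective h').symm
    rw [(Commute.all _ _).geom_sum₂_mul, ← div_eq_mul_inv, div_eq_iff hne, div_pow]
    field_simp
  rw [← prod_erase_Icc_natCast_sub hn hN, ← h1, ← prod_erase_mul _ _ (show n ∈ Icc 1 N by simp; omega),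
    hq, mul_pow, ← key]
  obtain ⟨p, rfl⟩ : ∃ p, m = p + 1 := ⟨m - 1, by omega⟩
  rw [Nat.add_sub_cancel]
  ring

theorem partialCoeff_eq_prod_GammaSeq {m n N : ℕ} (hm : 2 ≤ m) (hn : 1 ≤ n) (hN : n ≤ N) :
    -- `GammaSeq _ N` has `N + 1` denominator factors, hence the shift. The last two factors on the
    -- right tend to 1.
    (partialCoeff m (N + 1) n : ℂ) =
      m * (-1) ^ (n - 1) * (∏ r ∈ Icc 1 (m - 1), Complex.GammaSeq (1 - omegaRoot m ^ r * n) N) /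
        n.factorial * ((1 + 1 * N) / (0 + 1 * N)) ^ (m - 1 + n) *
        (((N + 1).descFactorial n : ℂ) / ((N + 1 : ℕ) : ℂ) ^ n) := by
  have h := prod_Icc_geom_sum₂ (N := N + 1) hm hn (by omega)
  rw [prod_GammaSeq_eq hm (by omega)]
  set Q := ∏ k ∈ Icc 1 (N + 1), ∑ i ∈ range m, (k : ℂ) ^ i * (n : ℂ) ^ (m - 1 - i) with hQ
  have hm0 : (m : ℂ) ≠ 0 := Nat.cast_ne_zero.2 (by omega)
  have hN0 : (N : ℂ) ≠ 0 := Nat.cast_ne_zero.2 (by omega)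
  have hN1 : (N : ℂ) + 1 ≠ 0 := Nat.cast_add_one_ne_zero N
  have hf : ∀ k : ℕ, (k.factorial : ℂ) ≠ 0 := fun k => Nat.cast_ne_zero.2 k.factorial_ne_zero
  have hQ0 : Q ≠ 0 := by
    intro h0
    rw [h0, zero_mul, zero_mul] at h
    exact mul_ne_zero hm0 (pow_ne_zero _ (hf _)) h.symm
  have hd := congrArg (Nat.cast (R := ℂ)) (Nat.factorial_mul_descFactorial (show n ≤ N + 1 by omega))
  obtain ⟨q, rfl⟩ : ∃ q, n = q + 1 := ⟨n - 1, by omega⟩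
  obtain ⟨p, rfl⟩ : ∃ p, m = p + 1 := ⟨m - 1, by omega⟩
  rw [Nat.cast_mul] at hd
  have hd' : ((N + 1).descFactorial (q + 1) : ℂ) = (N + 1).factorial / (N + 1 - (q + 1)).factorial := by
    rw [eq_div_iff (hf _), ← hd, mul_comm]
  have hpc : (partialCoeff (p + 1) (N + 1) (q + 1) : ℂ) =
      (p + 1 : ℕ) * ((N + 1).factorial : ℂ) ^ (p + 1) * (-1) ^ q /
        (Q * (q.factorial * (N + 1 - (q + 1)).factorial) * (q + 1 : ℕ)) := by
    have hq1 : ((q + 1 : ℕ) : ℂ) ≠ 0 := Nat.cast_ne_zero.2 (by omega)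
    rw [eq_div_iff (mul_ne_zero (mul_ne_zero hQ0 (mul_ne_zero (hf _) (hf _))) hq1), ← h]
    have : ((-1 : ℂ)) ^ q * (-1) ^ q = 1 := by rw [← mul_pow]; simp
    rw [Nat.add_sub_cancel]
    linear_combination (-(partialCoeff (p + 1) (N + 1) (q + 1) : ℂ) * Q *
      (q.factorial * (N + 1 - (q + 1)).factorial) * (q + 1 : ℕ)) * this
  rw [hpc, hd', Nat.add_sub_cancel, Nat.add_sub_cancel, Nat.factorial_succ N, Nat.factorial_succ q]
  have := hf N
  have := hf q
  have := hf (N + 1 - (q + 1))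
  push_cast
  have : (q : ℂ) + 1 ≠ 0 := Nat.cast_add_one_ne_zero q
  rw [add_comm (1 : ℂ) (1 * N), zero_add, one_mul, div_pow, mul_pow (_ + 1)]
  field_simp
  ring

theorem tendsto_partialCoeff {m n : ℕ} (hm : 2 ≤ m) (hn : 1 ≤ n) :
    Tendsto (fun N => (partialCoeff m N n : ℂ)) atTop
      (𝓝 (m * (-1) ^ (n - 1) * (∏ r ∈ Icc 1 (m - 1), Complex.Gamma (1 - omegaRoot m ^ r * n)) /
        n.factorial)) := by
  rw [← tendsto_add_atTop_iff_nat 1]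
  have hG : Tendsto (fun N => ∏ r ∈ Icc 1 (m - 1), Complex.GammaSeq (1 - omegaRoot m ^ r * n) N)
      atTop (𝓝 (∏ r ∈ Icc 1 (m - 1), Complex.Gamma (1 - omegaRoot m ^ r * n))) :=
    tendsto_finsetProd _ fun r _ => Complex.GammaSeq_tendsto_Gamma _
  have h1 := (tendsto_add_mul_div_add_mul_atTop_nhds (1 : ℂ) 0 1 one_ne_zero).pow (m - 1 + n)
  have h2 : Tendsto (fun N : ℕ => ((N.descFactorial n : ℝ) / (N : ℝ) ^ n)) atTop (𝓝 1) :=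
    (Asymptotics.isEquivalent_iff_tendsto_one
      (by filter_upwards [eventually_ne_atTop 0] with N hN; positivity)).1
      (isEquivalent_descFactorial n)
  have h3 := (Complex.continuous_ofReal.tendsto 1).comp ((tendsto_add_atTop_iff_nat 1).2 h2)
  have h := (((hG.const_mul (m * (-1) ^ (n - 1) : ℂ)).div_const (n.factorial : ℂ)).mul h1).mul h3
  rw [div_one, one_pow, Complex.ofReal_one, mul_one, mul_one] at h
  refine h.congr' ?_
  filter_upwards [eventually_ge_atTop n] with N hN
  rw [partialCoeff_eq_prod_GammaSeq hm hn hN]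
  simp

/-! ### Passage to the limit -/

theorem hasSum_zetaTerm {m : ℕ} (hm : 2 ≤ m) :
    HasSum (fun k : ℕ => zetaTerm m (k + 1)) (riemannZeta m) := by
  -- Extension by zero turns the finite sums into series over a fixed index set; `k` stands for `n =
  -- k + 1`.
  let f : ℕ → ℕ → ℂ := fun N k =>
    if k < N then (partialCoeff m N (k + 1) : ℂ) / ((k + 1 : ℕ) : ℂ) ^ m else 0
  let bound : ℕ → ℝ := fun k => 2 * (1 / ((k + 1 : ℕ) : ℝ) ^ m)
  have hbsum : Summable bound :=
    ((summable_nat_add_iff 1).2 (Real.summable_one_div_nat_pow.2 (by omega))).mul_left 2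
  have hlim : ∀ k, Tendsto (f · k) atTop (𝓝 (zetaTerm m (k + 1))) := by
    intro k
    have h := (tendsto_partialCoeff hm (Nat.le_add_left 1 k)).div_const (((k + 1 : ℕ) : ℂ) ^ m)
    rw [div_div] at h
    refine h.congr' ?_
    filter_upwards [eventually_gt_atTop k] with N hN
    simp only [f, if_pos hN]
  have hbound : ∀ N k, ‖f N k‖ ≤ bound k := by
    intro N k
    simp only [f, bound]
    split_ifs with hk
    · rw [norm_div, Complex.norm_real, norm_pow, Complex.norm_natCast, div_eq_mul_one_div]
      gcongr
      exact abs_partialCoeff_le_two hm (Nat.le_add_left 1 k) hk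
    · rw [norm_zero]; positivity
  have hsum : Summable fun k => zetaTerm m (k + 1) :=
    hbsum.of_norm_bounded fun k => le_of_tendsto (hlim k).norm (.of_forall fun N => hbound N k)
  have hT := tendsto_tsum_of_dominated_convergence hbsum hlim (.of_forall hbound)
  have hz : Summable fun k : ℕ => 1 / (k : ℂ) ^ m := by
    have := Real.summable_one_div_nat_pow.2 (show 1 < m by omega)
    simpa using Complex.ofRealCLM.summable this
  -- The extra term `k = 0` is `1 / 0 ^ m = 0`.
  have hfin : ∀ N, ∑' k, f N k = ∑ k ∈ range (N + 1), 1 / (k : ℂ) ^ m := by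
    intro N
    have h := congrArg Complex.ofReal (sum_partialCoeff_div_pow (m := m) (by omega) N)
    rw [tsum_eq_sum (s := range N) (fun k hk => if_neg (by simpa using hk)),
      sum_range_succ', Nat.cast_zero, zero_pow (by omega), div_zero, add_zero]
    rw [← Ico_add_one_right_eq_Icc, sum_Ico_eq_sum_range, sum_Ico_eq_sum_range,
      Nat.add_sub_cancel] at h
    push_cast at h
    rw [← sum_congr rfl fun k hk => (if_pos (mem_range.1 hk)).symm]
    push_cast
    simpa only [add_comm] using h
  have hT2 : Tendsto (fun N => ∑' k, f N k) atTop (𝓝 (riemannZeta m)) := by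
    simp only [hfin]
    rw [zeta_nat_eq_tsum_of_gt_one (by omega)]
    exact (tendsto_add_atTop_iff_nat 1).2 hz.hasSum.tendsto_sum_nat
  rw [← tendsto_nhds_unique hT hT2]
  exact hsum.hasSum

/-! ### The case `m = 3` -/

theorem omegaRoot_three : omegaRoot 3 = (-1 + Complex.I * (Real.sqrt 3 : ℂ)) / 2 := by
  have : 2 * (Real.pi : ℂ) * Complex.I / ((3 : ℕ) : ℂ) = ((Real.pi - Real.pi / 3 : ℝ) : ℂ) * Complex.I := by
    push_cast; ring
  rw [omegaRoot, this, Complex.exp_mul_I, ← Complex.ofReal_cos, ← Complex.ofReal_sin,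
    Real.cos_pi_sub, Real.sin_pi_sub, Real.cos_pi_div_three, Real.sin_pi_div_three]
  push_cast; ring

/-- Applying `Γ (1 + s) = s * Γ s` to both factors brings out `ω * ω ^ 2 * n ^ 2 = n ^ 2`, which
cancels against `n ^ 3`. -/
theorem aperyTerm_eq_zetaTerm {n : ℕ} (hn : n ≠ 0) : aperyTerm n = zetaTerm 3 n := by
  have hs : ((Real.sqrt 3 : ℝ) : ℂ) ^ 2 = 3 := by
    rw [← Complex.ofReal_pow, Real.sq_sqrt (by norm_num)]; norm_num
  have h1 : omegaRoot 3 = -((1 - Complex.I * (Real.sqrt 3 : ℂ)) / 2) := by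
    rw [omegaRoot_three]; ring
  have h2 : omegaRoot 3 ^ 2 = -((1 + Complex.I * (Real.sqrt 3 : ℂ)) / 2) := by
    rw [omegaRoot_three]
    linear_combination (-1 / 4 : ℂ) * hs + (Real.sqrt 3 : ℂ) ^ 2 / 4 * Complex.I_sq
  have h3 : omegaRoot 3 ^ 3 = 1 := (omegaRoot_isPrimitiveRoot three_ne_zero).pow_eq_one
  have hn' : (n : ℂ) ≠ 0 := Nat.cast_ne_zero.2 hn
  have hw : omegaRoot 3 ≠ 0 := Complex.exp_ne_zero _
  have hG : ∀ z : ℂ, z ≠ 0 → Complex.Gamma (1 - z * n) = -z * n * Complex.Gamma (-z * n) := by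
    intro z hz
    rw [← Complex.Gamma_add_one _ (mul_ne_zero (neg_ne_zero.2 hz) hn')]
    congr 1; ring
  have hI : Icc 1 (3 - 1) = {1, 2} := rfl
  rw [zetaTerm, hI, prod_pair (by norm_num), pow_one, hG _ hw, hG _ (pow_ne_zero 2 hw), aperyTerm]
  have e1 : (1 - Complex.I * (Real.sqrt 3 : ℂ)) / 2 = -omegaRoot 3 := by rw [h1, neg_neg]
  have e2 : (1 + Complex.I * (Real.sqrt 3 : ℂ)) / 2 = -omegaRoot 3 ^ 2 := by rw [h2, neg_neg]
  rw [e1, e2]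
  have hf : (n.factorial : ℂ) ≠ 0 := Nat.cast_ne_zero.2 n.factorial_ne_zero
  push_cast
  field_simp
  linear_combination (-Complex.Gamma (-(omegaRoot 3 * n)) * Complex.Gamma (-(omegaRoot 3 ^ 2 * n))) * h3

theorem mainTheorem6 :
    (∀ m : ℕ, 2 ≤ m → HasSum (fun k : ℕ => zetaTerm m (k + 1)) (riemannZeta (m : ℂ))) ∧
      HasSum (fun k : ℕ => aperyTerm (k + 1)) (riemannZeta 3) := by
  refine ⟨fun m hm => hasSum_zetaTerm hm, ?_⟩
  simp only [aperyTerm_eq_zetaTerm (Nat.succ_ne_zero _)]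
  exact_mod_cast hasSum_zetaTerm (m := 3) (by norm_num)
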